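/- All graphs are finite, simple and undirected. A linkage in a graph $G$ is a subgraph of $G$ each of whose connected components is a path (a single vertex is allowed as a path); its order is its number of components. For sets $\alpha,\beta\subseteq V(G)$, a linkage $P$ is an $(\alpha,\beta)$-linkage if one can choose one endpoint of each path of $P$ so that $\alpha$ is the set of the chosen endpoints and $\beta$ is the set of the other endpoints (a one-vertex path contributes its vertex to both $\alpha$ and $\beta$). It is $(\alpha,\beta)$-rigid if it is the only $(\alpha,\beta)$-linkage in $G$. Let $\mathcal S(G)$ be the set of real symmetric matrices $A=[a_{ij}]$ indexed by $V(G)$ such that, for $i\ne j$, $a_{ij}\neq 0$ if and only if $ij$ is an edge of $G$ (diagonal entries are arbitrary). For $S\subseteq V(G)$ let $A(S)$ be the submatrix of $A$ obtained by deleting the rows and columns with indices in $S$. For a square real matrix $M$ write $\operatorname{null}(M)=\dim\ker M$ and $\operatorname{mult}_M(\lambda)=\dim\{x: Mx=\lambda x\}$. Theorem. Let $P$ be an $(\alpha,\beta)$-rigid linkage of order $t$ in a graph $G$, and let $A\in\mathcal S(G)$. Then $$\operatorname{null}(A(V(P)))\ \ge\ \operatorname{null}(A)-t,$$ and for every real number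 $\lambda$ (in particular, for every eigenvalue $\lambda$ of $A$) $$\operatorname{mult}_{A(V(P))}(\lambda)\ \ge\ \operatorname{mult}_A(\lambda)-t .$$ -/

import Mathlib

namespace RigidLinkage

variable {V : Type*} {G : SimpleGraph V}

/-- The connected component `c` of a subgraph `P` of `G`, as a subgraph of `G`. -/
def component (P : G.Subgraph) (c : P.coe.ConnectedComponent) : G.Subgraph :=
  SimpleGraph.Subgraph.coeSubgraph c.toSubgraph

/-- The subgraph `H` of `G` is a path whose two ends are `u` and `v`.
A single vertex is a path, with `u = v`. -/
def IsPathBetween (H : G.Subgraph) (u v : V) : Prop :=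
  ∃ p : G.Walk u v, p.IsPath ∧ p.toSubgraph = H

/-- A linkage is a subgraph whose connected components are paths. -/
def IsLinkage (P : G.Subgraph) : Prop :=
  ∀ c : P.coe.ConnectedComponent, ∃ u v : V, IsPathBetween (component P c) u v

/-- The order of a linkage is its number of components. -/
noncomputable def order (P : G.Subgraph) : ℕ :=
  Nat.card P.coe.ConnectedComponent

/-- `P` is an `(α, β)`-linkage: `P` is a linkage, and one can choose one end `a c` of each path `c`
of `P` in such a way that `α` consists of the chosen ends and `β` consists of the other
ends `b c`. For a one-vertex path, `a c = b c` is that vertex. -/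
def IsLinkageBetween (P : G.Subgraph) (α β : Set V) : Prop :=
  IsLinkage P ∧
    ∃ a b : P.coe.ConnectedComponent → V,
      (∀ c, IsPathBetween (component P c) (a c) (b c)) ∧ α = Set.range a ∧ β = Set.range b

/-- `P` is `(α, β)`-rigid: it is the unique `(α, β)`-linkage in `G`. -/
def IsRigid (P : G.Subgraph) (α β : Set V) : Prop :=
  IsLinkageBetween P α β ∧ ∀ Q : G.Subgraph, IsLinkageBetween Q α β → Q = P

/-- The set `S(G)` of real symmetric matrices whose off-diagonal nonzero pattern is given by the
edges of `G`; the diagonal is free. -/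
def matricesOf (G : SimpleGraph V) : Set (Matrix V V ℝ) :=
  {A | A.IsSymm ∧ ∀ i j : V, i ≠ j → (A i j ≠ 0 ↔ G.Adj i j)}

/-- `A(S)`: the principal submatrix of `A` obtained by deleting the rows and columns
with indices in `S`. -/
def deleteIndices (A : Matrix V V ℝ) (S : Set V) : Matrix {v : V // v ∉ S} {v : V // v ∉ S} ℝ :=
  A.submatrix Subtype.val Subtype.val

/-- The nullity of a square real matrix: the dimension of its kernel. -/
noncomputable def nullity {n : Type*} [Fintype n] (A : Matrix n n ℝ) : ℕ :=
  Module.finrank ℝ (LinearMap.ker A.mulVecLin)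

/-- `mult A μ` is the dimension of `{x | A x = μ x}`. It is `0` if `μ` is not an eigenvalue. -/
noncomputable def mult {n : Type*} [Fintype n] (A : Matrix n n ℝ) (μ : ℝ) : ℕ :=
  Module.finrank ℝ (Module.End.eigenspace A.mulVecLin μ)

end RigidLinkage

/-!
Write `W` for the vertex set of the rigid linkage `P` and `S` for its complement. Orient each path
of `P` from its end `a c` in `α` to its end `b c` in `β`.

Suppose that `A(W)` is nonsingular. Replace each row `b c` of `A` by the unit vector at
`a c`, and expand the determinant by the Leibniz formula. A permutation with a nonzero term sends
`b c` to `a c` and every other vertex to itself or to a neighbour (`IsRouting`). Its orbits, cut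
open at `β`, contain paths that form an `(α, β)`-linkage (`IsRouting.exists_linkage`).
By rigidity this linkage is `P`, so that all these permutations agree on `W`
(`IsRouting.eqOn`). The determinant is therefore, up to sign, the product of the entries of `A` along
the edges of `P` times the determinant of `A(W)`, hence nonzero. So a vector of `ker A` that vanishes
on `α` is zero (`eq_zero_of_mulVec_eq_zero`).

If `A(W)` has nullity `k`, then changing at most `k` of its diagonal entries makes it
nonsingular (`exists_diagonal_perturbation`), and the changed `A` still belongs to `S(G)`. A vector
of `ker A` that vanishes on `α` and at the changed positions is in the kernel of the changed matrix,
and so it is zero. This gives `null A ≤ t + k`. The statement on multiplicities is the same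
inequality for `A - μ I`.
-/

namespace RigidLinkage

/-! ### Diagonal perturbations of symmetric matrices -/

/-- If `x` is a kernel vector of the symmetric matrix `M` with `x i ≠ 0`, then adding `1` to the
`i`-th diagonal entry lowers the nullity: pairing `M y = - y i • eᵢ` with `x` forces `y i = 0`. -/
theorem nullity_add_diagonal_single_lt {n : Type*} [Fintype n] [DecidableEq n]
    {M : Matrix n n ℝ} (hM : M.IsSymm) {x : n → ℝ} (hx : M.mulVec x = 0) {i : n} (hi : x i ≠ 0) :
    nullity (M + Matrix.diagonal (Pi.single i 1)) < nullity M := by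
  apply Submodule.finrank_lt_finrank_of_lt
  have key : ∀ y, (M + Matrix.diagonal (Pi.single i 1)).mulVec y = 0 → y i = 0 := by
    intro y hy
    have h1 : x ⬝ᵥ (M + Matrix.diagonal (Pi.single i 1)).mulVec y = 0 := by simp [hy]
    have h2 : x ⬝ᵥ M.mulVec y = 0 := by
      rw [Matrix.dotProduct_mulVec, ← Matrix.mulVec_transpose, hM.eq, hx, zero_dotProduct]
    have h3 : (Matrix.diagonal (Pi.single i (1 : ℝ))).mulVec y = Pi.single i (y i) := by
      ext j
      rcases eq_or_ne j i with rfl | h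
      · simp [Matrix.mulVec_diagonal]
      · simp [Matrix.mulVec_diagonal, h]
    rw [Matrix.add_mulVec, dotProduct_add, h2, zero_add, h3, dotProduct_single] at h1
    exact (mul_eq_zero.mp h1).resolve_left hi
  refine lt_of_le_of_ne (fun y hy => ?_) (fun h => hi (key x ?_))
  · rw [LinearMap.mem_ker, Matrix.mulVecLin_apply] at hy ⊢
    have h0 := key y hy
    rw [Matrix.add_mulVec] at hy
    have : (Matrix.diagonal (Pi.single i (1 : ℝ))).mulVec y = 0 := by
      ext j
      rcases eq_or_ne j i with rfl | h
      · simp [Matrix.mulVec_diagonal, h0]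
      · simp [Matrix.mulVec_diagonal, h]
    rwa [this, add_zero] at hy
  · have : x ∈ LinearMap.ker M.mulVecLin := hx
    rw [← h] at this
    exact this

/-- A symmetric matrix becomes nonsingular after changing at most `nullity M` diagonal entries. -/
theorem exists_diagonal_perturbation {n : Type*} [Fintype n] [DecidableEq n]
    (M : Matrix n n ℝ) (hM : M.IsSymm) :
    ∃ d : n → ℝ, {i | d i ≠ 0}.ncard ≤ nullity M ∧
      ∀ x, (M + Matrix.diagonal d).mulVec x = 0 → x = 0 := by
  induction hk : nullity M using Nat.strong_induction_on generalizing M with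
  | _ k ih =>
    by_cases h : ∀ x, M.mulVec x = 0 → x = 0
    · exact ⟨0, by simp, by simpa using h⟩
    push Not at h
    obtain ⟨x, hx, hx0⟩ := h
    obtain ⟨i, hi⟩ := Function.ne_iff.mp hx0
    have hlt := nullity_add_diagonal_single_lt hM hx hi
    obtain ⟨d, hd, hinj⟩ := ih _ (hk ▸ hlt) (M + Matrix.diagonal (Pi.single i 1))
      (hM.add (Matrix.isSymm_diagonal _)) rfl
    refine ⟨Pi.single i 1 + d, ?_, fun y hy => hinj y ?_⟩
    · have hsub : {j | (Pi.single i 1 + d : n → ℝ) j ≠ 0} ⊆ insert i {j | d j ≠ 0} := by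
        intro j hj
        rcases eq_or_ne j i with rfl | h
        · exact Set.mem_insert _ _
        · right
          simpa [h] using hj
      have h1 := Set.ncard_le_ncard hsub (Set.toFinite _)
      have h2 := Set.ncard_insert_le i {j | d j ≠ 0}
      omega
    · rwa [add_assoc, Matrix.diagonal_add]

/-! ### Linkages from families of disjoint paths -/

variable {V : Type*} {G : SimpleGraph V}

theorem component_verts (P : G.Subgraph) (c : P.coe.ConnectedComponent) :
    (component P c).verts = {x | ∃ h : x ∈ P.verts, P.coe.connectedComponentMk ⟨x, h⟩ = c} := by
  ext x
  simp [component]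

theorem component_adj (P : G.Subgraph) (c : P.coe.ConnectedComponent) (x y : V) :
    (component P c).Adj x y ↔ P.Adj x y ∧ x ∈ (component P c).verts := by
  rw [component_verts]
  simp only [component, SimpleGraph.Subgraph.coeSubgraph_adj]
  constructor
  · rintro ⟨hx, hy, h⟩
    exact ⟨(SimpleGraph.Subgraph.adj_sub _ h), hx, h.fst_mem⟩
  · rintro ⟨h, hx, hc⟩
    have hadj : P.coe.Adj ⟨x, hx⟩ ⟨y, P.edge_vert h.symm⟩ := h
    refine ⟨hx, P.edge_vert h.symm, hc, ?_, hadj⟩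
    exact (SimpleGraph.ConnectedComponent.sound hadj.symm.reachable).trans hc

/-- Pairwise disjoint paths are the components of their union, which is therefore a linkage between
the sets of their first and last vertices. -/
theorem isLinkageBetween_iSup {ι : Type*} {u v : ι → V} (p : ∀ i, G.Walk (u i) (v i))
    (hp : ∀ i, (p i).IsPath)
    (hdisj : ∀ i j x, x ∈ (p i).support → x ∈ (p j).support → i = j) :
    IsLinkageBetween (⨆ i, (p i).toSubgraph) (Set.range u) (Set.range v) := by
  set Q : G.Subgraph := ⨆ i, (p i).toSubgraph with hQ
  have hv : ∀ x, x ∈ Q.verts ↔ ∃ i, x ∈ (p i).support := by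
    intro x; simp [hQ]
  have hadj : ∀ x y, Q.Adj x y ↔ ∃ i, (p i).toSubgraph.Adj x y := by
    intro x y; simp [hQ]
  have hle : ∀ i, (p i).toSubgraph ≤ Q := fun i => le_iSup (fun i => (p i).toSubgraph) i
  have hstep : ∀ i x y, x ∈ (p i).support → Q.Adj x y → (p i).toSubgraph.Adj x y := by
    intro i x y hx h
    obtain ⟨j, hj⟩ := (hadj x y).mp h
    rwa [hdisj i j x hx ((p j).mem_verts_toSubgraph.mp hj.fst_mem)]
  have hclosed : ∀ i (x y : Q.verts), x.1 ∈ (p i).support → Q.coe.Reachable x y →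
      y.1 ∈ (p i).support := by
    rintro i x y hx ⟨w⟩
    induction w with
    | nil => exact hx
    | cons h _ ih => exact ih ((p i).mem_verts_toSubgraph.mp (hstep i _ _ hx h).snd_mem)
  have hcomp : ∀ i (x : Q.verts), x.1 ∈ (p i).support →
      component Q (Q.coe.connectedComponentMk x) = (p i).toSubgraph := by
    intro i x hx
    have hverts : (component Q (Q.coe.connectedComponentMk x)).verts = (p i).toSubgraph.verts := by
      ext y
      rw [component_verts, SimpleGraph.Walk.mem_verts_toSubgraph]
      constructor
      · rintro ⟨hy, h⟩
        exact hclosed i x ⟨y, hy⟩ hx (SimpleGraph.ConnectedComponent.exact h.symm)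
      · intro hy
        refine ⟨(hv y).mpr ⟨i, hy⟩, SimpleGraph.ConnectedComponent.sound ?_⟩
        have h := (p i).toSubgraph_connected.preconnected
          ⟨y, (p i).mem_verts_toSubgraph.mpr hy⟩ ⟨x, (p i).mem_verts_toSubgraph.mpr hx⟩
        exact h.map (SimpleGraph.Subgraph.inclusion (hle i))
    refine SimpleGraph.Subgraph.ext hverts ?_
    ext y z
    rw [component_adj, hverts, SimpleGraph.Walk.mem_verts_toSubgraph]
    constructor
    · rintro ⟨h, hy⟩
      exact hstep i y z hy h
    · intro h
      exact ⟨(hle i).2 h, (p i).mem_verts_toSubgraph.mp h.fst_mem⟩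
  have hidx : ∀ c : Q.coe.ConnectedComponent, ∃ i, component Q c = (p i).toSubgraph := by
    intro c
    induction c using SimpleGraph.ConnectedComponent.ind with
    | _ x =>
      obtain ⟨i, hi⟩ := (hv x).mp x.2
      exact ⟨i, hcomp i x hi⟩
  choose f hf using hidx
  have hfsurj : Function.Surjective f := by
    intro i
    have hu : u i ∈ Q.verts := (hv _).mpr ⟨i, (p i).start_mem_support⟩
    refine ⟨Q.coe.connectedComponentMk ⟨u i, hu⟩, ?_⟩
    have h := (hcomp i ⟨u i, hu⟩ (p i).start_mem_support).symm.trans (hf _)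
    refine (hdisj i _ (u i) (p i).start_mem_support ?_).symm
    rw [← SimpleGraph.Walk.mem_verts_toSubgraph, ← h]
    simp
  exact ⟨fun c => ⟨_, _, p (f c), hp _, (hf c).symm⟩, fun c => u (f c), fun c => v (f c),
    fun c => ⟨p (f c), hp _, (hf c).symm⟩, (hfsurj.range_comp u).symm,
    (hfsurj.range_comp v).symm⟩

/-! ### Routings -/

/-- A routing from the vertices `a i` to the vertices `b i`: a permutation of the vertices that
sends each `b i` back to `a i`, and every other vertex to itself or to a neighbour. Its orbits,
cut open at the `b i`, are disjoint paths leading from the `a i` to the `b i` (in some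
order), together with cycles, single edges and fixed points off these paths. -/
structure IsRouting (G : SimpleGraph V) {ι : Type*} (a b : ι → V) (σ : Equiv.Perm V) : Prop where
  map_end : ∀ i, σ (b i) = a i
  fixed_or_adj : ∀ v ∉ Set.range b, σ v = v ∨ G.Adj v (σ v)

theorem exists_walk_of_adj_succ (f : ℕ → V) (k : ℕ) (h : ∀ j < k, G.Adj (f j) (f (j + 1))) :
    ∃ p : G.Walk (f 0) (f k), p.support = (List.range (k + 1)).map f ∧
      p.edges = (List.range k).map fun j => s(f j, f (j + 1)) := by
  induction k with
  | zero => exact ⟨.nil, by simp, by simp⟩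
  | succ k ih =>
    obtain ⟨p, hs, he⟩ := ih fun j hj => h j (by omega)
    refine ⟨p.concat (h k (by omega)), ?_, ?_⟩
    · rw [SimpleGraph.Walk.support_concat, hs, List.range_succ (n := k + 1)]
      simp
    · rw [SimpleGraph.Walk.edges_concat, he, List.range_succ (n := k)]
      simp

namespace IsRouting

variable {ι : Type*} {a b : ι → V} {σ : Equiv.Perm V}

/-- Orbit segments that start at the `a i` and have not yet passed a `b j` do not meet: running `σ`
backwards from a common vertex reaches one of the starting vertices, whose predecessor
is a `b j`. -/
theorem iterate_inj_of_le (hσ : IsRouting G a b σ) {i i' : ι} {j k : ℕ} (hjk : j ≤ k)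
    (hk : ∀ l < k, σ^[l] (a i') ∉ Set.range b) (h : σ^[j] (a i) = σ^[k] (a i')) :
    a i = a i' ∧ j = k := by
  obtain ⟨l, rfl⟩ := Nat.exists_eq_add_of_le hjk
  rw [Function.iterate_add_apply] at h
  have h1 := σ.injective.iterate j h
  cases l with
  | zero => exact ⟨h1, by simp⟩
  | succ l =>
    rw [Function.iterate_succ_apply', ← hσ.map_end i] at h1
    exact absurd ⟨i, σ.injective h1⟩ (hk l (by omega))

theorem iterate_inj (hσ : IsRouting G a b σ) {i i' : ι} {j k : ℕ}
    (hj : ∀ l < j, σ^[l] (a i) ∉ Set.range b)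
    (hk : ∀ l < k, σ^[l] (a i') ∉ Set.range b) (h : σ^[j] (a i) = σ^[k] (a i')) :
    a i = a i' ∧ j = k := by
  rcases le_total j k with hjk | hjk
  · exact hσ.iterate_inj_of_le hjk hk h
  · obtain ⟨h1, h2⟩ := hσ.iterate_inj_of_le hjk hj h.symm
    exact ⟨h1.symm, h2.symm⟩

theorem exists_hit [Finite V] (hσ : IsRouting G a b σ) (i : ι) :
    ∃ m, σ^[m] (a i) ∈ Set.range b := by
  obtain ⟨m, hm⟩ := Nat.exists_eq_succ_of_ne_zero (orderOf_pos σ).ne'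
  refine ⟨m, i, σ.injective ?_⟩
  rw [hσ.map_end, ← Function.iterate_succ_apply' σ, ← hm, ← Equiv.Perm.coe_pow,
    pow_orderOf_eq_one]
  rfl

/-- Following a routing from each `a i` to the first `b j` on its orbit gives a linkage. -/
theorem exists_linkage [Finite V] (hσ : IsRouting G a b σ) (ha : Function.Injective a) :
    ∃ Q : G.Subgraph, IsLinkageBetween Q (Set.range a) (Set.range b) ∧
      (∀ x ∈ Q.verts, ∃ i k, σ^[k] (a i) = x ∧ ∀ l < k, σ^[l] (a i) ∉ Set.range b) ∧
      (∀ x y, Q.Adj x y → σ x = y ∨ (σ y = x ∧ y ∉ Set.range b)) ∧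
      ∀ x ∈ Q.verts, x ∉ Set.range b → Q.Adj x (σ x) := by
  classical
  have : Finite ι := Finite.of_injective a ha
  let m : ι → ℕ := fun i => Nat.find (hσ.exists_hit i)
  have hm : ∀ i, σ^[m i] (a i) ∈ Set.range b := fun i => Nat.find_spec (hσ.exists_hit i)
  have hlt : ∀ i, ∀ l < m i, σ^[l] (a i) ∉ Set.range b :=
    fun i l hl => Nat.find_min (hσ.exists_hit i) hl
  have hadj : ∀ i, ∀ j < m i, G.Adj (σ^[j] (a i)) (σ^[j + 1] (a i)) := by
    intro i j hj
    rw [Function.iterate_succ_apply']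
    refine (hσ.fixed_or_adj _ (hlt i j hj)).resolve_left fun h => ?_
    rw [← Function.iterate_succ_apply' σ] at h
    have := (hσ.iterate_inj (fun l hl => hlt i l (by omega)) (fun l hl => hlt i l (by omega)) h).2
    omega
  choose p hs he using fun i => exists_walk_of_adj_succ (fun j => σ^[j] (a i)) (m i) (hadj i)
  have hsupp : ∀ i x, x ∈ (p i).support ↔ ∃ k ≤ m i, σ^[k] (a i) = x := by
    intro i x
    simp only [hs, List.mem_map, List.mem_range, Nat.lt_succ_iff]
  have hpath : ∀ i, (p i).IsPath := by
    intro i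
    rw [SimpleGraph.Walk.isPath_def, hs]
    refine List.Nodup.map_on (fun j hj k hk h => ?_) List.nodup_range
    rw [List.mem_range] at hj hk
    exact (hσ.iterate_inj (fun l hl => hlt i l (by omega)) (fun l hl => hlt i l (by omega)) h).2
  have hdisj : ∀ i j x, x ∈ (p i).support → x ∈ (p j).support → i = j := by
    intro i i' x hx hx'
    rw [hsupp] at hx hx'
    obtain ⟨j, hj, rfl⟩ := hx
    obtain ⟨k, hk, h⟩ := hx'
    exact ha (hσ.iterate_inj (fun l hl => hlt i l (by omega)) (fun l hl => hlt i' l (by omega))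
      h.symm).1
  -- The last vertices are distinct members of the finite set `range b`, so they exhaust it.
  have hrange : Set.range (fun i => σ^[m i] (a i)) = Set.range b := by
    choose f hf using hm
    have hfi : Function.Injective f := by
      intro i j h
      refine hdisj i j (b (f i)) ?_ ?_
      · rw [hsupp]
        exact ⟨m i, le_rfl, (hf i).symm⟩
      · rw [hsupp, h]
        exact ⟨m j, le_rfl, (hf j).symm⟩
    simp only [← hf]
    exact (Finite.surjective_of_injective hfi).range_comp b
  refine ⟨⨆ i, (p i).toSubgraph, ?_, ?_, ?_, ?_⟩
  · have := isLinkageBetween_iSup p hpath hdisj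
    rw [hrange] at this
    exact this
  · intro x hx
    simp only [SimpleGraph.Subgraph.verts_iSup, SimpleGraph.Walk.verts_toSubgraph,
      Set.mem_iUnion, Set.mem_ofPred_eq] at hx
    obtain ⟨i, hx⟩ := hx
    obtain ⟨k, hk, h⟩ := (hsupp i x).mp hx
    exact ⟨i, k, h, fun l hl => hlt i l (by omega)⟩
  · intro x y h
    simp only [SimpleGraph.Subgraph.iSup_adj] at h
    obtain ⟨i, h⟩ := h
    rw [SimpleGraph.Walk.adj_toSubgraph_iff_mem_edges, he] at h
    simp only [List.mem_map, List.mem_range, Sym2.eq_iff] at h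
    obtain ⟨j, hj, ⟨rfl, rfl⟩ | ⟨rfl, rfl⟩⟩ := h
    · exact .inl (Function.iterate_succ_apply' σ j _).symm
    · exact .inr ⟨(Function.iterate_succ_apply' σ j _).symm, hlt i j hj⟩
  · intro x hx hxb
    simp only [SimpleGraph.Subgraph.verts_iSup, SimpleGraph.Walk.verts_toSubgraph,
      Set.mem_iUnion, Set.mem_ofPred_eq] at hx
    obtain ⟨i, hx⟩ := hx
    obtain ⟨k, hk, rfl⟩ := (hsupp i x).mp hx
    have hkm : k < m i := lt_of_le_of_ne hk fun h => hxb (h ▸ hm i)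
    simp only [SimpleGraph.Subgraph.iSup_adj]
    refine ⟨i, ?_⟩
    rw [SimpleGraph.Walk.adj_toSubgraph_iff_mem_edges, he]
    simp only [List.mem_map, List.mem_range]
    exact ⟨k, hkm, by rw [Function.iterate_succ_apply']⟩

/-- Two routings whose paths have the same union agree on it. The orientation of the paths is not a
problem, since an edge run through in opposite directions would give `σ (σ (a i)) = a i`. -/
theorem eqOn {τ : Equiv.Perm V} (hσ : IsRouting G a b σ) (hτ : IsRouting G a b τ)
    {Q : G.Subgraph}
    (hverts : ∀ x ∈ Q.verts, ∃ i k, σ^[k] (a i) = x ∧ ∀ l < k, σ^[l] (a i) ∉ Set.range b)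
    (hσadj : ∀ x ∈ Q.verts, x ∉ Set.range b → Q.Adj x (σ x))
    (hτadj : ∀ x y, Q.Adj x y → τ x = y ∨ (τ y = x ∧ y ∉ Set.range b))
    (ha : ∀ i, a i ∈ Q.verts) {x : V} (hx : x ∈ Q.verts) : σ x = τ x := by
  by_cases hxb : x ∈ Set.range b
  · obtain ⟨i, rfl⟩ := hxb
    rw [hσ.map_end, hτ.map_end]
  obtain ⟨i, k, rfl, hk⟩ := hverts x hx
  have main : ∀ k, (∀ l ≤ k, σ^[l] (a i) ∉ Set.range b) →
      σ^[k] (a i) ∈ Q.verts ∧ σ (σ^[k] (a i)) = τ (σ^[k] (a i)) := by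
    intro k
    induction k with
    | zero =>
      intro h
      have h0 := h 0 le_rfl
      refine ⟨ha i, ?_⟩
      rcases hτadj _ _ (hσadj _ (ha i) h0) with h1 | ⟨h1, h2⟩
      · exact h1.symm
      · rw [← hτ.map_end i] at h1
        refine absurd ⟨i, ?_⟩ h2
        rw [hτ.map_end i] at h1
        exact (τ.injective (h1.trans (hτ.map_end i).symm)).symm
    | succ k ih =>
      intro h
      obtain ⟨hv, heq⟩ := ih fun l hl => h l (by omega)
      have hv' : σ^[k + 1] (a i) ∈ Q.verts := by
        rw [Function.iterate_succ_apply']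
        exact Q.edge_vert (hσadj _ hv (h k (by omega))).symm
      refine ⟨hv', ?_⟩
      rcases hτadj _ _ (hσadj _ hv' (h _ le_rfl)) with h1 | ⟨h1, h2⟩
      · exact h1.symm
      · rw [Function.iterate_succ_apply' σ k, heq] at h1
        have h3 := τ.injective h1
        rw [← heq, ← Function.iterate_succ_apply' σ, ← Function.iterate_succ_apply' σ,
          Function.iterate_add_apply σ k 2] at h3
        have h4 : σ (σ (a i)) = a i := σ.injective.iterate k h3
        rw [← hσ.map_end i] at h4
        refine absurd ⟨i, ?_⟩ (h 1 (by omega))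
        rw [hσ.map_end i] at h4
        exact (σ.injective (h4.trans (hσ.map_end i).symm)).symm
  refine (main k fun l hl => ?_).2
  rcases hl.lt_or_eq with h | rfl
  · exact hk l h
  · exact hxb

end IsRouting

theorem formPerm_support_end [DecidableEq V] {u v : V} (p : G.Walk u v) :
    p.support.formPerm v = u := by
  cases p with
  | nil => simp
  | cons h p =>
    have := List.formPerm_apply_getLast u p.support
    rwa [List.getLast_cons p.support_ne_nil, SimpleGraph.Walk.getLast_support] at this

theorem adj_formPerm_support [DecidableEq V] {u v w : V} {p : G.Walk u v} (hp : p.IsPath)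
    (hw : w ∈ p.support) (hwv : w ≠ v) : G.Adj w (p.support.formPerm w) := by
  obtain ⟨k, hk, rfl⟩ := List.getElem_of_mem hw
  have hlen := p.length_support
  have hk' : k < p.length := by
    refine lt_of_le_of_ne (by omega) fun h => hwv ?_
    simp [h, SimpleGraph.Walk.support_getElem_eq_getVert]
  rw [List.formPerm_apply_lt_getElem _ hp.support_nodup k (by omega),
    SimpleGraph.Walk.support_getElem_eq_getVert, SimpleGraph.Walk.support_getElem_eq_getVert]
  exact p.adj_getVert_succ hk'

/-- The paths of a linkage, closed up to cycles, form a routing. -/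
theorem exists_isRouting [Finite V] {P : G.Subgraph} {a b : P.coe.ConnectedComponent → V}
    (h : ∀ c, IsPathBetween (component P c) (a c) (b c)) : ∃ σ, IsRouting G a b σ := by
  classical
  choose p hp hc using h
  have hsupp : ∀ c x, x ∈ (p c).support ↔
      ∃ h : x ∈ P.verts, P.coe.connectedComponentMk ⟨x, h⟩ = c := by
    intro c x
    rw [← SimpleGraph.Walk.mem_verts_toSubgraph, hc, component_verts]
    rfl
  let f : V → V := fun v =>
    if h : v ∈ P.verts then (p (P.coe.connectedComponentMk ⟨v, h⟩)).support.formPerm v else v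
  have hf : ∀ c v, v ∈ (p c).support → f v = (p c).support.formPerm v := by
    intro c v hv
    obtain ⟨h, rfl⟩ := (hsupp c v).mp hv
    simp only [f, dif_pos h]
  have hf' : ∀ v, v ∉ P.verts → f v = v := fun v hv => dif_neg hv
  have hmem : ∀ v (h : v ∈ P.verts), v ∈ (p (P.coe.connectedComponentMk ⟨v, h⟩)).support :=
    fun v h => (hsupp _ v).mpr ⟨h, rfl⟩
  have hfmem : ∀ c v, v ∈ (p c).support → f v ∈ (p c).support := by
    intro c v hv
    rw [hf c v hv]
    exact List.formPerm_apply_mem_of_mem hv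
  have hfP : ∀ v, f v ∈ P.verts ↔ v ∈ P.verts := by
    intro v
    by_cases h : v ∈ P.verts
    · exact iff_of_true ((hsupp _ _).mp (hfmem _ v (hmem v h))).1 h
    · rw [hf' v h]
  have hinj : Function.Injective f := by
    intro v w h
    by_cases hv : v ∈ P.verts
    · have hw : w ∈ P.verts := by rwa [← hfP, ← h, hfP]
      have h1 := hfmem _ v (hmem v hv)
      have h2 := hfmem _ w (hmem w hw)
      rw [h] at h1
      have h3 := hmem w hw
      obtain ⟨_, h1⟩ := (hsupp _ _).mp h1
      obtain ⟨_, h2⟩ := (hsupp _ _).mp h2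
      rw [← h2, h1] at h3
      rw [hf _ v (hmem v hv), hf _ w h3] at h
      exact (List.formPerm _).injective h
    · have hw : w ∉ P.verts := by rwa [← hfP, ← h, hfP]
      rwa [hf' v hv, hf' w hw] at h
  refine ⟨Equiv.ofBijective f (Finite.injective_iff_bijective.mp hinj), fun c => ?_,
    fun v hv => ?_⟩
  · rw [Equiv.ofBijective_apply, hf c _ (p c).end_mem_support, formPerm_support_end]
  · rw [Equiv.ofBijective_apply]
    by_cases h : v ∈ P.verts
    · right
      rw [hf _ v (hmem v h)]
      exact adj_formPerm_support (hp _) (hmem v h) fun h' => hv ⟨_, h'.symm⟩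
    · exact .inl (hf' v h)

/-! ### The determinant argument -/

open Matrix in
/-- Suppose that all routings agree with `e` on the set `W`, which they preserve. In the Leibniz
expansion of `A` with each row `b i` replaced by the unit vector at `a i`, only routings contribute.
Hence the determinant does not change if the rows in `W` are cut down to their entries at
`(v, e v)` and the remaining rows to the columns outside `W`; the matrix so obtained is
nonsingular as soon as the principal submatrix off `W` is. -/
theorem eq_zero_of_mulVec_eq_zero [Fintype V] {ι : Type*} {a b : ι → V} {e : Equiv.Perm V}
    {W : Set V} (hbW : Set.range b ⊆ W) (heW : ∀ v ∈ W, e v ∈ W) (he : ∀ i, e (b i) = a i)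
    (headj : ∀ v ∈ W, v ∉ Set.range b → G.Adj v (e v))
    (huniq : ∀ σ, IsRouting G a b σ → ∀ v ∈ W, σ v = e v)
    {A : Matrix V V ℝ} (hA : A ∈ matricesOf G)
    (hS : ∀ x : V → ℝ, (∀ v ∈ W, x v = 0) → (∀ v ∉ W, (A *ᵥ x) v = 0) → x = 0)
    {x : V → ℝ} (hxa : ∀ i, x (a i) = 0) (hx : ∀ v ∉ Set.range b, (A *ᵥ x) v = 0) : x = 0 := by
  classical
  let B : Matrix V V ℝ := fun i j =>
    if i ∈ Set.range b then (if j = e i then 1 else 0) else A i j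
  let B' : Matrix V V ℝ := fun i j =>
    if i ∈ W then (if j = e i then B i j else 0) else if j ∈ W then 0 else A i j
  have hsurj : ∀ w ∈ W, ∃ v ∈ W, e v = w := by
    intro w hw
    obtain ⟨v, hv⟩ := (e.subtypePermOfFintype heW).surjective ⟨w, hw⟩
    exact ⟨v, v.2, congrArg Subtype.val hv⟩
  have hdet : B.det = B'.det := by
    rw [← Matrix.det_transpose B, ← Matrix.det_transpose B', Matrix.det_apply, Matrix.det_apply]
    refine Finset.sum_congr rfl fun σ _ => congrArg _ ?_
    simp only [Matrix.transpose_apply]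
    by_cases hσ : ∀ v ∈ W, σ v = e v
    · refine Finset.prod_congr rfl fun v _ => ?_
      by_cases hv : v ∈ W
      · simp [B', hv, hσ v hv]
      · have h1 : σ v ∉ W := by
          intro h
          obtain ⟨w, hw, h2⟩ := hsurj _ h
          rw [← hσ w hw] at h2
          exact hv (σ.injective h2 ▸ hw)
        have h2 : v ∉ Set.range b := fun h => hv (hbW h)
        simp only [B', B, if_neg hv, if_neg h1, if_neg h2]
    · have hr : ¬ IsRouting G a b σ := fun h => hσ (huniq σ h)
      have hB : ∃ v, B v (σ v) = 0 := by
        by_contra! hne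
        refine hr ⟨fun i => ?_, fun v hv => ?_⟩
        · have := hne (b i)
          by_contra h
          rw [← he i] at h
          simp [B, h] at this
        · have := hne v
          simp only [B, if_neg hv] at this
          by_cases h : σ v = v
          · exact .inl h
          · exact .inr ((hA.2 v (σ v) (Ne.symm h)).mp this)
      push Not at hσ
      obtain ⟨w, hw, hne⟩ := hσ
      obtain ⟨v, hv⟩ := hB
      rw [Finset.prod_eq_zero (Finset.mem_univ v) hv,
        Finset.prod_eq_zero (Finset.mem_univ w) (by simp [B', hw, hne])]
  have hB' : B'.det ≠ 0 := by
    intro h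
    obtain ⟨y, hy0, hy⟩ := Matrix.exists_mulVec_eq_zero_iff.mpr h
    have hyW : ∀ w ∈ W, y w = 0 := by
      intro w hw
      obtain ⟨v, hv, rfl⟩ := hsurj w hw
      have h1 := congrFun hy v
      have h2 : (B' *ᵥ y) v = B v (e v) * y (e v) := by
        simp [Matrix.mulVec, dotProduct, B', hv]
      rw [h2, Pi.zero_apply] at h1
      refine (mul_eq_zero.mp h1).resolve_left ?_
      by_cases hb : v ∈ Set.range b
      · simp only [B, if_pos hb, if_true]
        exact one_ne_zero
      · simp only [B, if_neg hb]
        exact (hA.2 _ _ (headj v hv hb).ne).mpr (headj v hv hb)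
    refine hy0 (hS y hyW fun v hv => ?_)
    rw [← show (B' *ᵥ y) v = 0 from congrFun hy v]
    refine Finset.sum_congr rfl fun w _ => ?_
    by_cases hw : w ∈ W
    · simp [hyW w hw]
    · simp [B', hv, hw]
  by_contra hx0
  refine hB' (hdet ▸ Matrix.exists_mulVec_eq_zero_iff.mp ⟨x, hx0, ?_⟩)
  ext v
  by_cases hv : v ∈ Set.range b
  · obtain ⟨i, rfl⟩ := hv
    simp [Matrix.mulVec, dotProduct, B, he, hxa]
  · rw [Pi.zero_apply, ← hx v hv]
    refine Finset.sum_congr rfl fun w _ => ?_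
    simp only [B, if_neg hv]

/-! ### Nullities and multiplicities -/

theorem add_diagonal_mem_matricesOf [DecidableEq V] {A : Matrix V V ℝ} (hA : A ∈ matricesOf G)
    (d : V → ℝ) : A + Matrix.diagonal d ∈ matricesOf G := by
  refine ⟨hA.1.add (Matrix.isSymm_diagonal d), fun i j h => ?_⟩
  rw [Matrix.add_apply, Matrix.diagonal_apply_ne _ h, add_zero]
  exact hA.2 i j h

/-- The nullity inequality, with the subtraction moved to the other side. The starting vertices
account for `order P` coordinates of a kernel vector, and the support of the diagonal perturbation
for the remaining ones. -/
theorem nullity_le_order_add_nullity [Fintype V] (P : G.Subgraph) [Fintype {v // v ∉ P.verts}]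
    {α β : Set V} (hP : IsRigid P α β) {A : Matrix V V ℝ} (hA : A ∈ matricesOf G) :
    nullity A ≤ order P + nullity (deleteIndices A P.verts) := by
  classical
  obtain ⟨⟨-, a, b, hab, rfl, rfl⟩, huniq⟩ := hP
  have hstart : ∀ c, a c ∈ (component P c).verts := by
    intro c
    obtain ⟨p, -, hp⟩ := hab c
    rw [← hp]
    simp
  have hend : ∀ c, b c ∈ (component P c).verts := by
    intro c
    obtain ⟨p, -, hp⟩ := hab c
    rw [← hp]
    simp
  have haP : ∀ c, a c ∈ P.verts := by
    intro c
    have := hstart c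
    rw [component_verts] at this
    exact this.1
  have hbP : Set.range b ⊆ P.verts := by
    rintro _ ⟨c, rfl⟩
    have := hend c
    rw [component_verts] at this
    exact this.1
  have ha : Function.Injective a := by
    intro c c' h
    have h1 := hstart c
    have h2 := hstart c'
    rw [component_verts] at h1 h2
    obtain ⟨_, h1⟩ := h1
    obtain ⟨_, h2⟩ := h2
    rw [← h1, ← h2]
    simp only [h]
  -- By rigidity, every routing traces out `P`.
  have hroute : ∀ σ, IsRouting G a b σ →
      (∀ x ∈ P.verts, ∃ i k, σ^[k] (a i) = x ∧ ∀ l < k, σ^[l] (a i) ∉ Set.range b) ∧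
      (∀ x y, P.Adj x y → σ x = y ∨ (σ y = x ∧ y ∉ Set.range b)) ∧
      ∀ x ∈ P.verts, x ∉ Set.range b → P.Adj x (σ x) := by
    intro σ hσ
    obtain ⟨Q, hQ, h⟩ := hσ.exists_linkage ha
    rwa [huniq Q hQ] at h
  obtain ⟨e, he⟩ := exists_isRouting hab
  obtain ⟨-, headj, hadj⟩ := hroute e he
  have heW : ∀ v ∈ P.verts, e v ∈ P.verts := by
    intro v hv
    by_cases hvb : v ∈ Set.range b
    · obtain ⟨c, rfl⟩ := hvb
      rw [he.map_end]
      exact haP c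
    · exact P.edge_vert (hadj v hv hvb).symm
  obtain ⟨d, hd, hnon⟩ := exists_diagonal_perturbation (deleteIndices A P.verts)
    (hA.1.submatrix _)
  let D : V → ℝ := fun v => if h : v ∉ P.verts then d ⟨v, h⟩ else 0
  let T : Set {v // v ∉ P.verts} := {v | d v ≠ 0}
  have hA' := add_diagonal_mem_matricesOf hA D
  have hS : ∀ x : V → ℝ, (∀ v ∈ P.verts, x v = 0) →
      (∀ v ∉ P.verts, ((A + Matrix.diagonal D).mulVec x) v = 0) → x = 0 := by
    intro x hxW hx
    have h0 : (fun v : {v // v ∉ P.verts} => x v) = 0 := by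
      apply hnon
      ext v
      rw [Pi.zero_apply, ← hx v v.2, Matrix.add_mulVec, Matrix.add_mulVec, Pi.add_apply,
        Pi.add_apply, Matrix.mulVec_diagonal, Matrix.mulVec_diagonal]
      congr 1
      · simp only [Matrix.mulVec, dotProduct, deleteIndices, Matrix.submatrix_apply]
        rw [← Finset.sum_subtype (Finset.univ.filter (· ∉ P.verts)) (by simp)
          fun w => A v w * x w]
        refine Finset.sum_filter_of_ne fun w _ h hw => h ?_
        rw [hxW w hw, mul_zero]
      · simp [D, v.2]
    ext v
    by_cases hv : v ∈ P.verts
    · exact hxW v hv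
    · exact congrFun h0 ⟨v, hv⟩
  -- A kernel vector of `A` is determined by its entries on the starting vertices and on the support
  -- of the perturbation.
  let L : (V → ℝ) →ₗ[ℝ] (P.coe.ConnectedComponent → ℝ) × (T → ℝ) :=
    (LinearMap.funLeft ℝ ℝ a).prod (LinearMap.funLeft ℝ ℝ fun v : T => (v : {v // v ∉ P.verts}).1)
  have hinj : Function.Injective (L ∘ₗ (LinearMap.ker A.mulVecLin).subtype) := by
    rw [← LinearMap.ker_eq_bot, LinearMap.ker_eq_bot']
    rintro ⟨x, hx⟩ hLx
    have h1 : ∀ c, x (a c) = 0 := fun c => congrFun (congrArg Prod.fst hLx) c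
    have h2 : ∀ v : T, x (v : {v // v ∉ P.verts}).1 = 0 :=
      fun v => congrFun (congrArg Prod.snd hLx) v
    refine Subtype.ext ?_
    refine eq_zero_of_mulVec_eq_zero hbP heW he.map_end (fun v hv hvb => (hadj v hv hvb).adj_sub)
      (fun σ hσ v hv => hσ.eqOn he (hroute σ hσ).1 (hroute σ hσ).2.2 headj haP hv)
      hA' hS h1 (fun v _ => ?_)
    have h3 : A.mulVec x = 0 := hx
    rw [Matrix.add_mulVec, h3, zero_add, Matrix.mulVec_diagonal]
    by_cases hv : v ∉ P.verts
    · by_cases hdv : d ⟨v, hv⟩ = 0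
      · simp [D, hv, hdv]
      · exact mul_eq_zero_of_right _ (h2 ⟨⟨v, hv⟩, hdv⟩)
    · simp [D, hv]
  have hle := LinearMap.finrank_le_finrank_of_injective hinj
  have : Fintype P.coe.ConnectedComponent := Fintype.ofFinite _
  rw [Module.finrank_prod, Module.finrank_fintype_fun_eq_card, Module.finrank_fintype_fun_eq_card,
    ← Nat.card_eq_fintype_card, ← Nat.card_eq_fintype_card, Nat.card_coe_set_eq] at hle
  exact hle.trans (Nat.add_le_add_left hd _)

theorem mult_eq_nullity {n : Type*} [Fintype n] [DecidableEq n] (A : Matrix n n ℝ) (μ : ℝ) :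
    mult A μ = nullity (A + Matrix.diagonal fun _ => -μ) := by
  unfold mult nullity
  have : A.mulVecLin - μ • (1 : Module.End ℝ (n → ℝ)) =
      (A + Matrix.diagonal fun _ => -μ).mulVecLin := by
    refine LinearMap.ext fun x => ?_
    ext i
    simp [sub_eq_add_neg]
  rw [Module.End.eigenspace_def, this]

theorem deleteIndices_add_diagonal [DecidableEq V] (A : Matrix V V ℝ) (S : Set V) (μ : ℝ) :
    deleteIndices (A + Matrix.diagonal fun _ => μ) S =
      deleteIndices A S + Matrix.diagonal fun _ => μ := by
  ext i j
  simp [deleteIndices, Matrix.diagonal_apply, Subtype.ext_iff]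

end RigidLinkage

theorem theorem3p3 {V : Type*} [Fintype V] (G : SimpleGraph V) (P : G.Subgraph)
    [DecidablePred (· ∈ P.verts)] (α β : Set V) (hP : RigidLinkage.IsRigid P α β)
    (t : ℕ) (ht : RigidLinkage.order P = t)
    (A : Matrix V V ℝ) (hA : A ∈ RigidLinkage.matricesOf G) :
    ((RigidLinkage.nullity A : ℤ) - t ≤
        RigidLinkage.nullity (RigidLinkage.deleteIndices A P.verts)) ∧
      ∀ μ : ℝ, (RigidLinkage.mult A μ : ℤ) - t ≤
        RigidLinkage.mult (RigidLinkage.deleteIndices A P.verts) μ := by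
  classical
  subst ht
  constructor
  · have := RigidLinkage.nullity_le_order_add_nullity P hP hA
    omega
  · intro μ
    have := RigidLinkage.nullity_le_order_add_nullity P hP
      (RigidLinkage.add_diagonal_mem_matricesOf hA fun _ => -μ)
    rw [RigidLinkage.deleteIndices_add_diagonal] at this
    rw [RigidLinkage.mult_eq_nullity, RigidLinkage.mult_eq_nullity]
    omega
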